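/- Let $(M,g)$ be a smooth Riemannian manifold (Hausdorff, second countable, finite-dimensional, without boundary), and let $\mu$ be a Borel probability measure on $M$ which is absolutely continuous with respect to the Riemannian volume measure. Let $T:[0,1]\to[0,\infty)$ be non-decreasing and such that $x\mapsto T(x)/x$ is non-increasing on $(0,1]$. Assume that there is a constant $C\ge 0$ such that the following Beckner-type inequality holds: for every smooth function $f:M\to\mathbb R$ and every $p\in(1,2)$, $$\int f^2\,d\mu-\Big(\int|f|^p\,d\mu\Big)^{2/p}\le C\,T(2-p)\int|\nabla f|^2\,d\mu .$$ Define $\beta:[1,\infty)\to[0,\infty)$ by $\beta(s)=T\big(1/\log(1+s)\big)$ for $s\ge e-1$ and $\beta(s)=T(1)$ for $1\le s\le e-1$. Then $\mu$ satisfies the following super-Poincaré inequality: for every smooth function $f:M\to\mathbb R$ and every $s\ge 1$, $$\int f^2\,d\mu-s\Big(\int|f|\,d\mu\Big)^2\le 48\,C\,\beta(s)\int|\nabla f|^2\,d\mu .$$ (All integrals are of non-negative functions and take values in $[0,\infty]$, with the convention $0\cdot\infty=0$; in both inequalities the subtracted term is to be read as added to the right-hand side.) -/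

import Mathlib

open MeasureTheory Set Bundle
open scoped Manifold ContDiff Bundle ENNReal NNReal

noncomputable section

namespace RiemannianSP

section Volume

variable {n : ℕ} {M : Type*} [TopologicalSpace M] [ChartedSpace (EuclideanSpace ℝ (Fin n)) M]
  [RiemannianBundle (fun x : M => TangentSpace (𝓡 n) x)]

/-- The `i`-th coordinate vector field `∂ᵢ` of the preferred chart around `x`, at the point of `M`
whose coordinates in this chart are `y`. -/
def coordVector (x : M) (y : EuclideanSpace ℝ (Fin n)) (i : Fin n) :
    TangentSpace (𝓡 n) ((chartAt (EuclideanSpace ℝ (Fin n)) x).symm y) :=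
  mfderiv (𝓡 n) (𝓡 n) (chartAt (EuclideanSpace ℝ (Fin n)) x).symm y
    (EuclideanSpace.basisFun (Fin n) ℝ i : EuclideanSpace ℝ (Fin n))

/-- The matrix `(gᵢⱼ)` of the Riemannian metric in the preferred chart around `x`. -/
def metricMatrix (x : M) (y : EuclideanSpace ℝ (Fin n)) : Matrix (Fin n) (Fin n) ℝ :=
  Matrix.of fun i j => inner ℝ (coordVector x y i) (coordVector x y j)

variable [MeasurableSpace M]

/-- The Riemannian volume of the domain of the preferred chart around `x`: the measure with density
`√(det gᵢⱼ)` with respect to Lebesgue measure on the image of the chart, transported to `M`. -/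
def chartVolume (x : M) : Measure M :=
  Measure.map (chartAt (EuclideanSpace ℝ (Fin n)) x).symm
    ((volume.restrict (chartAt (EuclideanSpace ℝ (Fin n)) x).target).withDensity
      fun y => ENNReal.ofReal (Real.sqrt (metricMatrix x y).det))

variable (n M) in
/-- The Riemannian volume measure. The measures `chartVolume x` agree on the intersections of the
chart domains, so their least upper bound is the measure obtained by gluing them. -/
def riemannianVolume : Measure M := ⨆ x : M, chartVolume (n := n) x

end Volume

section Inequalities

variable {n : ℕ} {M : Type*} [TopologicalSpace M] [ChartedSpace (EuclideanSpace ℝ (Fin n)) M]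
  [RiemannianBundle (fun x : M => TangentSpace (𝓡 n) x)]

instance (x : M) : FiniteDimensional ℝ (TangentSpace (𝓡 n) x) :=
  inferInstanceAs (FiniteDimensional ℝ (EuclideanSpace ℝ (Fin n)))

instance (x : M) : CompleteSpace (TangentSpace (𝓡 n) x) := FiniteDimensional.complete ℝ _

variable (n) in
/-- The differential of a real function at `x`, as a linear form on the tangent space. -/
def differential (f : M → ℝ) (x : M) : StrongDual ℝ (TangentSpace (𝓡 n) x) :=
  mfderiv (𝓡 n) 𝓘(ℝ, ℝ) f x

variable (n) in
/-- The Riemannian gradient: `⟪∇f x, v⟫ = df_x v` for every tangent vector `v` at `x`. -/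
def gradient (f : M → ℝ) (x : M) : TangentSpace (𝓡 n) x :=
  (InnerProductSpace.toDual ℝ (TangentSpace (𝓡 n) x)).symm (differential n f x)

theorem inner_gradient (f : M → ℝ) (x : M) (v : TangentSpace (𝓡 n) x) :
    inner ℝ (gradient n f x) v = differential n f x v :=
  InnerProductSpace.toDual_symm_apply

variable [MeasurableSpace M]

variable (n) in
/-- The Dirichlet energy `∫ |∇f|² dμ ∈ [0, ∞]`. -/
def energy (μ : Measure M) (f : M → ℝ) : ℝ≥0∞ := ∫⁻ x, ‖gradient n f x‖ₑ ^ 2 ∂μ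

variable (n) in
/-- The Beckner-type inequality with rate function `T` (on `[0, 1]`) and constant `C`: for all
smooth `f` and all `p ∈ (1, 2)`, `∫ f² dμ - (∫ |f|ᵖ dμ)^(2/p) ≤ C T(2 - p) ∫ |∇f|² dμ`.
The subtracted term stands on the right, since integrals may be infinite. -/
def Beckner (μ : Measure M) (T : ℝ → ℝ≥0) (C : ℝ≥0) : Prop :=
  ∀ f : M → ℝ, ContMDiff (𝓡 n) 𝓘(ℝ, ℝ) ∞ f → ∀ p ∈ Ioo (1 : ℝ) 2,
    ∫⁻ x, ‖f x‖ₑ ^ 2 ∂μ ≤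
      (∫⁻ x, ‖f x‖ₑ ^ p ∂μ) ^ (2 / p) + (C : ℝ≥0∞) * (T (2 - p) : ℝ≥0∞) * energy n μ f

variable (n) in
/-- The super-Poincaré inequality with function `β` (on `[1, ∞)`): for all smooth `f` and all
`s ≥ 1`, `∫ f² dμ - s (∫ |f| dμ)² ≤ β(s) ∫ |∇f|² dμ`, again with the subtracted term on the
right. -/
def SuperPoincare (μ : Measure M) (β : ℝ → ℝ≥0) : Prop :=
  ∀ f : M → ℝ, ContMDiff (𝓡 n) 𝓘(ℝ, ℝ) ∞ f → ∀ s : ℝ, 1 ≤ s →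
    ∫⁻ x, ‖f x‖ₑ ^ 2 ∂μ ≤
      ENNReal.ofReal s * (∫⁻ x, ‖f x‖ₑ ∂μ) ^ 2 + (β s : ℝ≥0∞) * energy n μ f

end Inequalities

open Classical in
/-- `β(s) = T(1 / log(1 + s))` for `s ≥ e - 1`, and `β(s) = T(1)` for `1 ≤ s ≤ e - 1`. -/
def betaOf (T : ℝ → ℝ≥0) (s : ℝ) : ℝ≥0 :=
  if Real.exp 1 - 1 ≤ s then T (1 / Real.log (1 + s)) else T 1

end RiemannianSP

end

/-!
The proof applies the Beckner inequality to the function itself, at a single exponent `p`.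

Let `f` be bounded and smooth, and put `A = ∫ |f|`, `X = ∫ f²`, `a = (2 - p) / p`. By Hölder,
`(∫ |f|ᵖ)^(2/p) ≤ (A²)ᵃ X¹⁻ᵃ` (`lintegral_rpow_rpow_two_div_le`), so that Beckner's inequality reads
`X ≤ (A²)ᵃ X¹⁻ᵃ + C T(2 - p) ∫ |∇f|²`. If `X ≤ s A²` there is nothing to prove. Otherwise the first
term is at most `s⁻ᵃ X` and can be absorbed into the left-hand side.

* If `s > e - 1`, take `p = 2 - 1 / log (1 + s)`. Then `s⁻ᵃ ≤ 4/5`, which gives the inequality with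
  constant `5` (`le_add_five_mul_of_le_rpow_mul_rpow_add`).
* If `s ≤ e - 1`, use `T(2 - p) ≤ T(1)` and let `p → 1`, that is `a → 1`
  (`le_add_of_forall_le_rpow_mul_rpow_add`).

Boundedness of `f` is used only to ensure `X < ∞`. A general smooth `f` is approximated by
`fₖ = k sin (f / k)`, which is smooth and bounded, with `|fₖ| ≤ |f|` and `|∇fₖ| ≤ |∇f|`, and tends to
`f` pointwise; Fatou's lemma (`lintegral_sq_le_of_forall_truncation`) concludes.
-/

open MeasureTheory Set Filter Topology Bundle
open scoped Manifold ContDiff Bundle ENNReal NNReal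

namespace RiemannianSP

/-! ### Interpolation between the first and the second moment -/

theorem lintegral_rpow_rpow_two_div_le {α : Type*} [MeasurableSpace α] {μ : Measure α}
    {g : α → ℝ≥0∞} (hg : AEMeasurable g μ) {p : ℝ} (hp : p ∈ Ioo (1 : ℝ) 2) :
    (∫⁻ x, g x ^ p ∂μ) ^ (2 / p) ≤
      ((∫⁻ x, g x ∂μ) ^ 2) ^ ((2 - p) / p) * (∫⁻ x, g x ^ 2 ∂μ) ^ (1 - (2 - p) / p) := by
  obtain ⟨h1, h2⟩ := hp
  have hp0 : (0 : ℝ) < p := by linarith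
  have key : ∫⁻ x, g x ^ p ∂μ ≤ (∫⁻ x, g x ∂μ) ^ (2 - p) * (∫⁻ x, g x ^ 2 ∂μ) ^ (p - 1) := by
    have h := ENNReal.lintegral_mul_norm_pow_le (μ := μ) hg (hg.pow_const 2)
      (p := 2 - p) (q := p - 1) (by linarith) (by linarith) (by ring)
    refine le_trans (le_of_eq (lintegral_congr fun x => ?_)) h
    rw [← ENNReal.rpow_natCast, ← ENNReal.rpow_mul,
      ← ENNReal.rpow_add_of_nonneg _ _ (by linarith) (by norm_num; linarith)]
    congr 1
    push_cast
    ring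
  refine (ENNReal.rpow_le_rpow key (by positivity)).trans (le_of_eq ?_)
  rw [ENNReal.mul_rpow_of_nonneg _ _ (by positivity), ← ENNReal.rpow_mul, ← ENNReal.rpow_mul,
    ← ENNReal.rpow_natCast, ← ENNReal.rpow_mul]
  congr 2
  · push_cast
    field_simp
  · field_simp
    ring

/-! ### Absorbing the interpolated term -/

/-- For the exponent `p = 2 - 1 / log (1 + s)`, the absorbed fraction of the second moment is
bounded away from `1`, uniformly in `s`. -/
theorem rpow_neg_le_four_fifths {s a : ℝ} (hs : Real.exp 1 - 1 < s)
    (ha : 1 / (2 * Real.log (1 + s)) ≤ a) : s ^ (-a) ≤ 4 / 5 := by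
  have he := Real.exp_one_gt_d9
  have hs' : (1.7 : ℝ) < s := by linarith
  have hs0 : 0 < s := by linarith
  have hlog : 0 < Real.log (1 + s) := Real.log_pos (by linarith)
  -- `1 + s ≤ s²`, since `s` exceeds the golden ratio
  have hle : Real.log (1 + s) ≤ 2 * Real.log s := by
    rw [← Real.log_rpow hs0]
    apply Real.log_le_log (by linarith)
    norm_num
    nlinarith
  have hls : 0 ≤ Real.log s := by linarith
  have h4 : 1 / 4 ≤ Real.log s * a := by
    calc 1 / 4 = Real.log (1 + s) / 2 * (1 / (2 * Real.log (1 + s))) := by field_simp; norm_num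
      _ ≤ Real.log s * a := by gcongr; linarith
  rw [Real.rpow_def_of_pos hs0, mul_neg, Real.exp_neg]
  have h5 : 5 / 4 ≤ Real.exp (Real.log s * a) := by
    have := Real.add_one_le_exp (Real.log s * a)
    linarith
  calc (Real.exp (Real.log s * a))⁻¹ ≤ (5 / 4)⁻¹ := inv_anti₀ (by norm_num) h5
    _ = 4 / 5 := by norm_num

theorem le_add_five_mul_of_le_rpow_mul_rpow_add {X Y K : ℝ≥0∞} {s a : ℝ} (hX : X ≠ ⊤)
    (hs : 0 < s) (ha : 0 ≤ a) (hsa : s ^ (-a) ≤ 4 / 5)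
    (h : X ≤ Y ^ a * X ^ (1 - a) + K) : X ≤ ENNReal.ofReal s * Y + 5 * K := by
  rcases le_or_gt X (ENNReal.ofReal s * Y) with hle | hlt
  · exact hle.trans le_self_add
  refine le_trans ?_ le_add_self
  have hX0 : X ≠ 0 := (pos_of_gt hlt).ne'
  have hs' : ENNReal.ofReal s ≠ 0 := by simpa using hs
  have hY : Y ≤ ENNReal.ofReal s⁻¹ * X := by
    rw [ENNReal.ofReal_inv_of_pos hs, mul_comm, ← div_eq_mul_inv]
    rw [ENNReal.le_div_iff_mul_le (Or.inl hs') (Or.inl ENNReal.ofReal_ne_top), mul_comm]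
    exact hlt.le
  have habs : Y ^ a * X ^ (1 - a) ≤ ENNReal.ofReal (4 / 5) * X := by
    calc Y ^ a * X ^ (1 - a)
        ≤ (ENNReal.ofReal s⁻¹ * X) ^ a * X ^ (1 - a) := by gcongr
      _ = ENNReal.ofReal (s ^ (-a)) * X := by
        rw [ENNReal.mul_rpow_of_nonneg _ _ ha, mul_assoc, ← ENNReal.rpow_add _ _ hX0 hX,
          add_sub_cancel, ENNReal.rpow_one, ENNReal.ofReal_rpow_of_pos (by positivity),
          Real.inv_rpow hs.le, Real.rpow_neg hs.le]
      _ ≤ ENNReal.ofReal (4 / 5) * X := by gcongr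
  have h' := h.trans (add_le_add_left habs K)
  rcases eq_or_ne K ⊤ with rfl | hK
  · simp
  lift X to ℝ≥0 using hX
  lift K to ℝ≥0 using hK
  have h4 : ENNReal.ofReal (4 / 5) = ((4 / 5 : ℝ≥0) : ℝ≥0∞) := by
    rw [← ENNReal.ofReal_coe_nnreal]
    norm_num
  rw [h4] at h'
  norm_cast at h' ⊢
  rw [← NNReal.coe_le_coe] at h' ⊢
  push_cast at h' ⊢
  linarith

theorem le_add_of_forall_le_rpow_mul_rpow_add {X Y K : ℝ≥0∞} (hX : X ≠ ⊤) (hY : Y ≠ ⊤)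
    (h : ∀ p ∈ Ioo (1 : ℝ) 2, X ≤ Y ^ ((2 - p) / p) * X ^ (1 - (2 - p) / p) + K) :
    X ≤ Y + K := by
  rcases eq_or_ne X 0 with rfl | hX0
  · simp
  have hq : Tendsto (fun p : ℝ => (2 - p) / p) (𝓝[>] 1) (𝓝 1) := by
    have : ContinuousAt (fun p : ℝ => (2 - p) / p) 1 := by fun_prop (disch := norm_num)
    have h1 := this.tendsto
    norm_num at h1
    exact h1.mono_left nhdsWithin_le_nhds
  -- continuity of `q ↦ c ^ q` at a positive exponent, or for positive `c`
  have hYt : Tendsto (fun p : ℝ => Y ^ ((2 - p) / p)) (𝓝[>] 1) (𝓝 Y) := by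
    lift Y to ℝ≥0 using hY
    have hev : ∀ᶠ p : ℝ in 𝓝[>] 1, (((Y ^ ((2 - p) / p) : ℝ≥0)) : ℝ≥0∞) =
        (Y : ℝ≥0∞) ^ ((2 - p) / p) := by
      filter_upwards [hq.eventually (lt_mem_nhds one_pos)] with p hp
      exact ENNReal.coe_rpow_of_nonneg _ hp.le
    refine Tendsto.congr' hev (ENNReal.tendsto_coe.2 ?_)
    simpa using (tendsto_const_nhds (x := Y)).nnrpow hq (Or.inr one_pos)
  have hXt : Tendsto (fun p : ℝ => X ^ (1 - (2 - p) / p)) (𝓝[>] 1) (𝓝 1) := by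
    lift X to ℝ≥0 using hX
    have hX0' : X ≠ 0 := by exact_mod_cast hX0
    simp_rw [← ENNReal.coe_rpow_of_ne_zero hX0']
    have h0 : Tendsto (fun p : ℝ => 1 - (2 - p) / p) (𝓝[>] 1) (𝓝 0) := by
      simpa using hq.const_sub 1
    have := (tendsto_const_nhds (x := X)).nnrpow h0 (Or.inl hX0')
    exact ENNReal.tendsto_coe.2 (by simpa using this)
  have hlim : Tendsto (fun p : ℝ => Y ^ ((2 - p) / p) * X ^ (1 - (2 - p) / p) + K) (𝓝[>] 1)
      (𝓝 (Y + K)) := by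
    have := (ENNReal.Tendsto.mul hYt (Or.inr ENNReal.one_ne_top) hXt (Or.inr hY)).add
      (tendsto_const_nhds (x := K))
    simpa using this
  refine ge_of_tendsto hlim ?_
  filter_upwards [Ioo_mem_nhdsGT (one_lt_two : (1 : ℝ) < 2)] with p hp using h p hp

/-! ### Smooth truncation -/

/-- The bounded smooth truncation `t ↦ c sin (t / c)` of the identity at level `c = k + 1`. -/
noncomputable def truncation (k : ℕ) (t : ℝ) : ℝ := (k + 1) * Real.sin (t / (k + 1))

theorem contDiff_truncation (k : ℕ) : ContDiff ℝ ∞ (truncation k) := by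
  unfold truncation
  fun_prop

theorem hasDerivAt_truncation (k : ℕ) (t : ℝ) :
    HasDerivAt (truncation k) (Real.cos (t / (k + 1))) t := by
  have hk : (k + 1 : ℝ) ≠ 0 := by positivity
  have h := (((hasDerivAt_id t).div_const (k + 1 : ℝ)).sin).const_mul (k + 1 : ℝ)
  refine h.congr_deriv ?_
  simp only [id]
  field_simp

theorem abs_truncation_le_abs (k : ℕ) (t : ℝ) : |truncation k t| ≤ |t| := by
  have hk : (0 : ℝ) < k + 1 := by positivity
  rw [truncation, abs_mul, abs_of_pos hk]
  calc (k + 1 : ℝ) * |Real.sin (t / (k + 1))| ≤ (k + 1) * |t / (k + 1)| := by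
        exact mul_le_mul_of_nonneg_left Real.abs_sin_le_abs hk.le
    _ = |t| := by
        rw [abs_div, abs_of_pos hk]
        field_simp

theorem abs_truncation_le (k : ℕ) (t : ℝ) : |truncation k t| ≤ k + 1 := by
  have hk : (0 : ℝ) < k + 1 := by positivity
  rw [truncation, abs_mul, abs_of_pos hk]
  exact mul_le_of_le_one_right hk.le (Real.abs_sin_le_one _)

theorem tendsto_truncation (t : ℝ) : Tendsto (fun k => truncation k t) atTop (𝓝 t) := by
  have h0 : Tendsto (fun k : ℕ => t / ((k : ℝ) + 1)) atTop (𝓝 0) := by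
    simpa [div_eq_mul_inv] using (tendsto_one_div_add_atTop_nhds_zero_nat (𝕜 := ℝ)).const_mul t
  have h1 : Tendsto (fun k : ℕ => t * Real.sinc (t / ((k : ℝ) + 1))) atTop (𝓝 t) := by
    simpa using ((Real.continuous_sinc.tendsto 0).comp h0).const_mul t
  refine h1.congr fun k => ?_
  have hk : (k + 1 : ℝ) ≠ 0 := by positivity
  rcases eq_or_ne t 0 with rfl | ht
  · simp [truncation]
  · rw [Real.sinc_of_ne_zero (by positivity), truncation]
    field_simp

theorem lintegral_sq_le_of_forall_truncation {α : Type*} [MeasurableSpace α] {μ : Measure α}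
    {f : α → ℝ} (hf : Measurable f) {B : ℝ≥0∞}
    (h : ∀ k, ∫⁻ x, ‖truncation k (f x)‖ₑ ^ 2 ∂μ ≤ B) : ∫⁻ x, ‖f x‖ₑ ^ 2 ∂μ ≤ B := by
  have hlim : ∀ x, Tendsto (fun k => ‖truncation k (f x)‖ₑ ^ 2) atTop (𝓝 (‖f x‖ₑ ^ 2)) :=
    fun x => ((ENNReal.continuous_pow 2).tendsto _).comp (tendsto_truncation (f x)).enorm
  calc ∫⁻ x, ‖f x‖ₑ ^ 2 ∂μ = ∫⁻ x, liminf (fun k => ‖truncation k (f x)‖ₑ ^ 2) atTop ∂μ :=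
        lintegral_congr fun x => (hlim x).liminf_eq.symm
    _ ≤ liminf (fun k => ∫⁻ x, ‖truncation k (f x)‖ₑ ^ 2 ∂μ) atTop :=
        lintegral_liminf_le fun k =>
          (((contDiff_truncation k).continuous.measurable.comp hf).enorm).pow_const 2
    _ ≤ B := liminf_le_of_frequently_le' (Frequently.of_forall h)

/-! ### The gradient of a composition -/

section Manifold

variable {n : ℕ} {M : Type*} [TopologicalSpace M] [ChartedSpace (EuclideanSpace ℝ (Fin n)) M]
  [RiemannianBundle (fun x : M => TangentSpace (𝓡 n) x)]

theorem gradient_comp {f : M → ℝ} {φ : ℝ → ℝ} {φ' : ℝ} {x : M}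
    (hφ : HasDerivAt φ φ' (f x)) (hf : MDifferentiableAt (𝓡 n) 𝓘(ℝ, ℝ) f x) :
    gradient n (φ ∘ f) x = φ' • gradient n f x := by
  have hd : differential n (φ ∘ f) x = φ' • differential n f x := by
    unfold differential
    have hc := (hφ.hasFDerivAt.hasMFDerivAt.comp x hf.hasMFDerivAt).mfderiv
    refine hc.trans ?_
    ext v
    exact mul_comm (differential n f x v) φ'
  simp [gradient, hd]

variable [MeasurableSpace M]

theorem energy_truncation_le {μ : Measure M} {f : M → ℝ}
    (hf : MDifferentiable (𝓡 n) 𝓘(ℝ, ℝ) f) (k : ℕ) :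
    energy n μ (truncation k ∘ f) ≤ energy n μ f := by
  refine lintegral_mono fun x => ?_
  rw [gradient_comp (hasDerivAt_truncation k (f x)) (hf x), enorm_smul]
  gcongr
  refine mul_le_of_le_one_left' ?_
  rw [← ofReal_norm, Real.norm_eq_abs]
  simpa using Real.abs_cos_le_one (f x / (k + 1))

/-! ### From Beckner to super-Poincaré -/

/-- The super-Poincaré inequality, with the better constant `5`, for smooth functions with finite
moments. -/
theorem Beckner.superPoincare_of_ne_top {μ : Measure M} {T : ℝ → ℝ≥0} {C : ℝ≥0}
    (hC : Beckner n μ T C) (hT : MonotoneOn T (Icc 0 1)) {f : M → ℝ}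
    (hf : ContMDiff (𝓡 n) 𝓘(ℝ, ℝ) ∞ f) (hfm : AEMeasurable f μ) (h1 : ∫⁻ x, ‖f x‖ₑ ∂μ ≠ ⊤)
    (h2 : ∫⁻ x, ‖f x‖ₑ ^ 2 ∂μ ≠ ⊤) {s : ℝ} (hs : 1 ≤ s) :
    ∫⁻ x, ‖f x‖ₑ ^ 2 ∂μ ≤ ENNReal.ofReal s * (∫⁻ x, ‖f x‖ₑ ∂μ) ^ 2 +
      5 * ((C : ℝ≥0∞) * (betaOf T s : ℝ≥0∞) * energy n μ f) := by
  have hB : ∀ p ∈ Ioo (1 : ℝ) 2, ∫⁻ x, ‖f x‖ₑ ^ 2 ∂μ ≤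
      ((∫⁻ x, ‖f x‖ₑ ∂μ) ^ 2) ^ ((2 - p) / p) * (∫⁻ x, ‖f x‖ₑ ^ 2 ∂μ) ^ (1 - (2 - p) / p) +
        (C : ℝ≥0∞) * (T (2 - p) : ℝ≥0∞) * energy n μ f := fun p hp =>
    (hC f hf p hp).trans (add_le_add_left (lintegral_rpow_rpow_two_div_le hfm.enorm hp) _)
  rcases lt_or_ge (Real.exp 1 - 1) s with hes | hes
  · have hlog : 1 < Real.log (1 + s) := by
      rw [Real.lt_log_iff_exp_lt (by linarith)]
      linarith
    have hinv : 1 / Real.log (1 + s) < 1 := by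
      rw [div_lt_one (by linarith)]
      exact hlog
    have hinv0 : 0 < 1 / Real.log (1 + s) := by positivity
    have h := hB (2 - 1 / Real.log (1 + s)) ⟨by linarith, by linarith⟩
    rw [sub_sub_cancel] at h
    rw [betaOf, if_pos hes.le]
    have ha : 1 / (2 * Real.log (1 + s)) ≤
        1 / Real.log (1 + s) / (2 - 1 / Real.log (1 + s)) := by
      rw [mul_comm, ← div_div]
      exact div_le_div_of_nonneg_left hinv0.le (by linarith) (by linarith)
    exact le_add_five_mul_of_le_rpow_mul_rpow_add h2 (by linarith)
      (le_trans (by positivity) ha) (rpow_neg_le_four_fifths hes ha) h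
  · -- the two branches of `betaOf` agree at the common endpoint `s = e - 1`
    have hβ : betaOf T s = T 1 := by
      rw [betaOf]
      split_ifs with h
      · rw [le_antisymm hes h]
        simp
      · rfl
    rw [hβ]
    have h := le_add_of_forall_le_rpow_mul_rpow_add
      (K := (C : ℝ≥0∞) * (T 1 : ℝ≥0∞) * energy n μ f) h2 (ENNReal.pow_ne_top h1) fun p hp => by
        refine (hB p hp).trans ?_
        have hTp : T (2 - p) ≤ T 1 :=
          hT ⟨by linarith [hp.2], by linarith [hp.1]⟩ (right_mem_Icc.2 zero_le_one)
            (by linarith [hp.1])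
        gcongr
    refine h.trans (add_le_add ?_ ?_)
    · exact le_mul_of_one_le_left' (by simpa using hs)
    · exact le_mul_of_one_le_left' (by norm_num)

end Manifold

end RiemannianSP

theorem mainTheorem4 {n : ℕ} {M : Type*} [TopologicalSpace M] [T2Space M]
    [SecondCountableTopology M] [ChartedSpace (EuclideanSpace ℝ (Fin n)) M]
    [IsManifold (𝓡 n) ∞ M] [RiemannianBundle (fun x : M => TangentSpace (𝓡 n) x)]
    [IsContMDiffRiemannianBundle (𝓡 n) ∞ (EuclideanSpace ℝ (Fin n))
      (fun x : M => TangentSpace (𝓡 n) x)]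
    [MeasurableSpace M] [BorelSpace M] (μ : Measure M) [IsProbabilityMeasure μ]
    (hμ : μ ≪ RiemannianSP.riemannianVolume n M)
    (T : ℝ → ℝ≥0) (hT : MonotoneOn T (Icc 0 1))
    (hT' : AntitoneOn (fun x : ℝ => (T x : ℝ) / x) (Ioc 0 1))
    (C : ℝ≥0) (hC : RiemannianSP.Beckner n μ T C) :
    RiemannianSP.SuperPoincare n μ (fun s => 48 * C * RiemannianSP.betaOf T s) := by
  intro f hf s hs
  have hfm : Measurable f := hf.continuous.measurable
  refine RiemannianSP.lintegral_sq_le_of_forall_truncation hfm fun k => ?_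
  have hle : ∀ x, ‖RiemannianSP.truncation k (f x)‖ₑ ≤ ‖f x‖ₑ := fun x =>
    enorm_le_iff_norm_le.2 (RiemannianSP.abs_truncation_le_abs k (f x))
  have hbd : ∀ x, ‖RiemannianSP.truncation k (f x)‖ₑ ≤ ENNReal.ofReal (k + 1) := fun x => by
    rw [← ofReal_norm]
    exact ENNReal.ofReal_le_ofReal (RiemannianSP.abs_truncation_le k (f x))
  have h1 : ∫⁻ x, ‖RiemannianSP.truncation k (f x)‖ₑ ∂μ ≠ ⊤ :=
    ((lintegral_mono hbd).trans_lt (by simp)).ne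
  have h2 : ∫⁻ x, ‖RiemannianSP.truncation k (f x)‖ₑ ^ 2 ∂μ ≠ ⊤ :=
    ((lintegral_mono fun x => pow_le_pow_left' (hbd x) 2).trans_lt (by simp)).ne
  have hsm : ContMDiff (𝓡 n) 𝓘(ℝ, ℝ) ∞ (RiemannianSP.truncation k ∘ f) :=
    (RiemannianSP.contDiff_truncation k).contMDiff.comp hf
  refine (hC.superPoincare_of_ne_top hT hsm hsm.continuous.measurable.aemeasurable h1 h2 hs).trans
    (add_le_add ?_ ?_)
  · gcongr with x
    exact hle x
  · push_cast
    calc 5 * ((C : ℝ≥0∞) * (RiemannianSP.betaOf T s : ℝ≥0∞) *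
          RiemannianSP.energy n μ (RiemannianSP.truncation k ∘ f))
        ≤ 48 * ((C : ℝ≥0∞) * (RiemannianSP.betaOf T s : ℝ≥0∞) * RiemannianSP.energy n μ f) := by
          gcongr
          · norm_num
          · exact RiemannianSP.energy_truncation_le (hf.mdifferentiable (by simp)) k
      _ = _ := by ring
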